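/- **Setting.** Let $m\ge 2$, $d\ge 0$, $0<\mu$ and $L\ge 2\mu$. Let $f_1,\dots,f_m:\mathbb R^d\to\mathbb R$ be $\mu$-strongly convex and $L$-smooth, i.e. differentiable with $f_i(y)\le f_i(x)+\langle\nabla f_i(x),y-x\rangle+\frac L2\|x-y\|^2$ for all $x,y$. Let $g:\mathbb R^d\to\mathbb R$ be convex (possibly non-smooth), let $F(x)=\frac1m\sum_{i=1}^m f_i(x)+g(x)$, and let $x^*$ be the minimizer of $F$. Let $W\in\mathbb R^{m\times m}$ be a weight matrix of an undirected network on the $m$ agents: $W$ is symmetric, $0\preceq W\preceq I$, $W_{ij}\ne0$ if and only if $i=j$ or $i,j$ are adjacent, $W\mathbf 1=\mathbf 1$, and $\mathrm{null}(I-W)=\mathrm{span}(\mathbf 1)$. Let $\lambda_2(W)$ be its second largest eigenvalue. For $\mathbf x\in\mathbb R^{m\times d}$ let $\mathbf x^{(i)}$ be its $i$-th row, $\overline x=\frac1m\mathbf 1^\top\mathbf x$, $\|\mathbf x\|$ the Frobenius norm, and $\Pi=I-\frac1m\mathbf 1\mathbf 1^\top$. $\mathrm{FastMix}(\mathbf x,K)$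 returns $\mathbf x^K$, where $\mathbf x^0=\mathbf x^1=\mathbf x$, $\mathbf x^{k+1}=(1+\eta_w)W\mathbf x^k-\eta_w\mathbf x^{k-1}$ for $k\ge1$, and $\eta_w=\frac1{1+\sqrt{1-\lambda_2^2(W)}}$. For $\alpha>0$ put $\mathrm{prox}_{\alpha g}(v)=\arg\min_w\{\alpha g(w)+\frac12\|w-v\|^2\}$, applied to each row of a matrix. **Algorithm.** Given $x_1\in\mathbb R^d$, put $\widehat\gamma=\frac1{20\sqrt{(L-\mu)\mu}}$, $\widehat\tau=\mu\widehat\gamma$, let $K$ be any integer with $K\ge\frac{11}{\sqrt{1-\lambda_2(W)}}$ (for instance the least one), and write $\nabla\widehat f(\mathbf x)$ for the $m\times d$ matrix with rows $\nabla f_i(\mathbf x^{(i)})-\mu\mathbf x^{(i)}$. Start from $\mathbf x_1=\mathbf y_1=\mathbf z_1=\mathbf 1x_1$ and $\mathbf s_1=\nabla\widehat f(\mathbf x_1)$, and for $t\ge1$ let $$\mathbf x_{t+1}=\widehat\tau\mathbf z_t+(1-\widehat\tau)\mathbf y_t,\qquad \mathbf s_{t+1}=\mathrm{FastMix}\big(\mathbf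 s_t+\nabla\widehat f(\mathbf x_{t+1})-\nabla\widehat f(\mathbf x_t),K\big),$$ $$\mathbf z_{t+1}=\mathrm{FastMix}\Big(\mathrm{prox}_{\frac{\widehat\gamma}{1+\mu\widehat\gamma}g}\Big(\tfrac1{1+\mu\widehat\gamma}(\mathbf z_t-\widehat\gamma\mathbf s_{t+1})\Big),K\Big),\qquad \mathbf y_{t+1}=\mathrm{FastMix}\big(\widehat\tau\mathbf z_{t+1}+(1-\widehat\tau)\mathbf y_t,K\big).$$ **Theorem.** For every integer $T\ge1$, $$\|\mathbf z_T-\mathbf 1x^*\|^2\le\Big(1-\frac1{40}\sqrt{\frac{\mu}{L-\mu}}\Big)^T\Big(\frac{2m}{\mu}\big(F(\overline y_1)-F(x^*)\big)+\|\mathbf z_1-\mathbf 1x^*\|^2+\frac{6\cdot20^2(L-\mu)}{\mu}\big(\|\Pi\mathbf x_1\|^2+c_1\|\Pi\mathbf y_1\|^2+c_2\|\Pi\mathbf z_1\|^2+c_3\widehat\gamma^2\|\Pi\mathbf s_1\|^2\big)\Big),$$ with $c_1=64$, $c_2=\frac{9\widehat\tau^2}{32}$ and $c_3=\frac{5\widehat\tau^2}{14}$.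 -/

import Mathlib

noncomputable section

/-- The local copies of the `m` agents: an `m × d` real matrix, given by its rows. -/
abbrev Agents (m d : ℕ) : Type := Fin m → EuclideanSpace ℝ (Fin d)

namespace Agents

variable {m d : ℕ}

/-- The matrix `𝟏 v`, all of whose rows are equal to `v`. -/
def const (m : ℕ) (v : EuclideanSpace ℝ (Fin d)) : Agents m d := fun _ => v

/-- The average `(1 / m) 𝟏ᵀ x` of the rows. -/
def avg (x : Agents m d) : EuclideanSpace ℝ (Fin d) := (1 / (m : ℝ)) • ∑ i, x i

/-- The squared Frobenius norm. -/
def normSq (x : Agents m d) : ℝ := ∑ i, ‖x i‖ ^ 2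

/-- The matrix product `A x`. -/
def leftMul (A : Matrix (Fin m) (Fin m) ℝ) (x : Agents m d) : Agents m d :=
  fun i => ∑ j, A i j • x j

end Agents

/-- The projection matrix `Π = I - 𝟏 𝟏ᵀ / m`. -/
def consensusProj (m : ℕ) : Matrix (Fin m) (Fin m) ℝ :=
  1 - (1 / (m : ℝ)) • Matrix.of (fun _ _ => (1 : ℝ))

/-- `f` is differentiable and satisfies the quadratic upper bound with constant `L`. -/
def IsLSmooth {d : ℕ} (L : ℝ) (f : EuclideanSpace ℝ (Fin d) → ℝ) : Prop :=
  Differentiable ℝ f ∧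
    ∀ x y, f y ≤ f x + inner ℝ (gradient f x) (y - x) + L / 2 * ‖x - y‖ ^ 2

/-- `F = (1 / m) ∑ fᵢ + g`. -/
def compositeObj {m d : ℕ} (f : Fin m → EuclideanSpace ℝ (Fin d) → ℝ)
    (g : EuclideanSpace ℝ (Fin d) → ℝ) (x : EuclideanSpace ℝ (Fin d)) : ℝ :=
  (1 / (m : ℝ)) * ∑ i, f i x + g x

/-- Weight matrices of an undirected network `G` of `m` agents: `W` is symmetric with
`0 ⪯ W ⪯ I`, its support is given by the edges of `G` and the diagonal, `W 𝟏 = 𝟏`, and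
`null (I - W) = span 𝟏` (which forces `G` to be connected). -/
structure IsWeightMatrix {m : ℕ} (G : SimpleGraph (Fin m)) (W : Matrix (Fin m) (Fin m) ℝ) :
    Prop where
  posSemidef : W.PosSemidef
  le_one : (1 - W).PosSemidef
  support : ∀ i j, W i j ≠ 0 ↔ G.Adj i j ∨ i = j
  mulVec_one : W.mulVec (fun _ => 1) = fun _ => 1
  null : LinearMap.ker (Matrix.toLin' (1 - W)) = Submodule.span ℝ {fun _ => (1 : ℝ)}

/-- The second largest eigenvalue (with multiplicity) of a real symmetric `m × m` matrix,
`m ≥ 2`; `eigenvalues₀` lists the eigenvalues in decreasing order, starting at index `0`. -/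
def lambda2 {m : ℕ} {W : Matrix (Fin m) (Fin m) ℝ} (hW : W.IsHermitian) (hm : 2 ≤ m) : ℝ :=
  hW.eigenvalues₀ ⟨1, by rw [Fintype.card_fin]; omega⟩

/-- The momentum parameter of `FastMix`, as a function of the second largest eigenvalue. -/
def mixEta (lam : ℝ) : ℝ := 1 / (1 + √(1 - lam ^ 2))

/-- The iterates of `FastMix`: `x⁰ = x¹` is the input and
`xᵏ⁺¹ = (1 + η) W xᵏ - η xᵏ⁻¹` for `k ≥ 1`. -/
def fastMixSeq {m d : ℕ} (W : Matrix (Fin m) (Fin m) ℝ) (η : ℝ) (x : Agents m d) :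
    ℕ → Agents m d
  | 0 => x
  | 1 => x
  | k + 2 => (1 + η) • Agents.leftMul W (fastMixSeq W η x (k + 1)) - η • fastMixSeq W η x k

/-- `FastMix (x, K)`: the iterate `xᴷ`. -/
def fastMix {m d : ℕ} (W : Matrix (Fin m) (Fin m) ℝ) (η : ℝ) (K : ℕ) (x : Agents m d) :
    Agents m d :=
  fastMixSeq W η x K

/-- The proximal operator: `prox_{γ g} (v)` is a minimizer of `w ↦ γ g(w) + ‖w - v‖² / 2`. -/
def prox {d : ℕ} (γ : ℝ) (g : EuclideanSpace ℝ (Fin d) → ℝ) (v : EuclideanSpace ℝ (Fin d)) :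
    EuclideanSpace ℝ (Fin d) :=
  Classical.epsilon fun w => IsMinOn (fun u => γ * g u + 1 / 2 * ‖u - v‖ ^ 2) Set.univ w

/-- The aggregated gradient of `f̂ᵢ = fᵢ - (μ / 2) ‖·‖²`; row `i` is `∇ fᵢ (xᵢ) - μ xᵢ`. -/
def gradHat {m d : ℕ} (μ : ℝ) (f : Fin m → EuclideanSpace ℝ (Fin d) → ℝ) (x : Agents m d) :
    Agents m d :=
  fun i => gradient (f i) (x i) - μ • x i

/-- The variables `(x_t, y_t, z_t, s_t)` of the algorithm. -/
structure OdapgState (m d : ℕ) where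
  x : Agents m d
  y : Agents m d
  z : Agents m d
  s : Agents m d

/-- Initialization: `z₁ = y₁ = x₁ = 𝟏 x₁` and `s₁ = ∇ f̂ (x₁)`. -/
def odapgInit {m d : ℕ} (μ : ℝ) (f : Fin m → EuclideanSpace ℝ (Fin d) → ℝ)
    (x₁ : EuclideanSpace ℝ (Fin d)) : OdapgState m d where
  x := Agents.const m x₁
  y := Agents.const m x₁
  z := Agents.const m x₁
  s := gradHat μ f (Agents.const m x₁)

/-- One round, from index `t` to index `t + 1`; `mix` is the consensus operator. -/
def odapgStep {m d : ℕ} (μ γ τ : ℝ) (f : Fin m → EuclideanSpace ℝ (Fin d) → ℝ)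
    (g : EuclideanSpace ℝ (Fin d) → ℝ) (mix : Agents m d → Agents m d)
    (p : OdapgState m d) : OdapgState m d :=
  let x' : Agents m d := τ • p.z + (1 - τ) • p.y
  let s' : Agents m d := mix (p.s + gradHat μ f x' - gradHat μ f p.x)
  let z' : Agents m d := mix fun i =>
    prox (γ / (1 + μ * γ)) g ((1 / (1 + μ * γ)) • (p.z i - γ • s' i))
  let y' : Agents m d := mix (τ • z' + (1 - τ) • p.y)
  { x := x', y := y', z := z', s := s' }

/-- The state after `n` rounds; the variables with index `t ≥ 1` are those after `t - 1`
rounds. -/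
def odapg {m d : ℕ} (μ γ τ : ℝ) (f : Fin m → EuclideanSpace ℝ (Fin d) → ℝ)
    (g : EuclideanSpace ℝ (Fin d) → ℝ) (mix : Agents m d → Agents m d)
    (x₁ : EuclideanSpace ℝ (Fin d)) : ℕ → OdapgState m d
  | 0 => odapgInit μ f x₁
  | n + 1 => odapgStep μ γ τ f g mix (odapg μ γ τ f g mix x₁ n)

end

/-!
Moving `μ/2 ‖·‖²` from the `f i` to `g` leaves `F` unchanged and makes the smooth parts convex and
`(L - μ)`-smooth, and the nonsmooth part `μ`-strongly convex.  In an eigenbasis of `W`, `fastMix`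
is a scalar momentum recursion; it preserves averages, and after `c / √(1 - λ₂)` steps it has
shrunk the squared distance to consensus by the factor `3 * 2 ^ (-c)`.  Preservation of averages
makes the average of `s` equal to that of the local gradients, so the averaged iterates perform an
accelerated proximal gradient step that is inexact only through the disagreement of `x`, `y`, `z`
and `s`.  Cocoercivity of the shifted gradients yields a negative term in the descent inequality,
and this term absorbs the gradient-tracking error.  Hence the objective gap, the squared distance
to the minimizer and the weighted consensus errors add up to a Lyapunov function contracting by
`1 - τ / 2` per round.
-/

section Momentum

lemma mixEta_pos (l : ℝ) : 0 < mixEta l := by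
  unfold mixEta
  positivity

lemma mixEta_pow_le {l : ℝ} (h0 : 0 ≤ l) (h1 : l < 1) {c : ℝ} {K : ℕ}
    (hK : c / √(1 - l) ≤ (K : ℝ)) : mixEta l ^ K ≤ (2 : ℝ) ^ (-c) := by
  have hgap : 0 < √(1 - l) := Real.sqrt_pos.mpr (by linarith)
  have hle : √(1 - l) ≤ √(1 - l ^ 2) := Real.sqrt_le_sqrt (by nlinarith)
  have hs1 : √(1 - l ^ 2) ≤ 1 := Real.sqrt_le_one.mpr (by nlinarith)
  rw [mixEta]
  set s := √(1 - l ^ 2)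
  have hs0 : 0 < s := hgap.trans_le hle
  have hc : c ≤ s * K := by
    rw [div_le_iff₀' hgap] at hK
    exact hK.trans (by gcongr)
  have bernoulli : (2 : ℝ) ^ s ≤ 1 + s := by
    have := rpow_one_add_le_one_add_mul_self (s := 1) (by norm_num) hs0.le hs1
    rwa [mul_one, one_add_one_eq_two] at this
  calc (1 / (1 + s)) ^ K ≤ (1 / (2 : ℝ) ^ s) ^ K := by gcongr
    _ = (2 : ℝ) ^ (-(s * K)) := by
      rw [one_div, ← Real.rpow_neg (by norm_num), ← Real.rpow_mul_natCast (by norm_num), neg_mul]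
    _ ≤ (2 : ℝ) ^ (-c) := Real.rpow_le_rpow_of_exponent_le (by norm_num) (by linarith)

lemma mixEta_discriminant_ge {l l₂ : ℝ} (h0 : 0 ≤ l) (hl : l ≤ l₂) (h1 : l₂ ≤ 1) :
    (1 + mixEta l₂) * (1 - l) ≤ 3 * (mixEta l₂ - (1 + mixEta l₂) ^ 2 * l ^ 2 / 4) := by
  have hs2 : √(1 - l₂ ^ 2) ^ 2 = 1 - l₂ ^ 2 := Real.sq_sqrt (by nlinarith)
  rw [mixEta]
  set s := √(1 - l₂ ^ 2)
  have hs0 : 0 ≤ s := Real.sqrt_nonneg _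
  have hpoly : 0 ≤ 4 * (1 - s ^ 2 - l ^ 2) + l * ((8 + 12 * s + 3 * s ^ 2) * (1 - l) + s ^ 2) := by
    have hsq : 0 ≤ 1 - s ^ 2 - l ^ 2 := by nlinarith
    have hl1 : 0 ≤ 1 - l := by linarith
    positivity
  have hdiff : 3 * (1 / (1 + s) - (1 + 1 / (1 + s)) ^ 2 * l ^ 2 / 4) -
      (1 + 1 / (1 + s)) * (1 - l) =
      (4 * (1 - s ^ 2 - l ^ 2) + l * ((8 + 12 * s + 3 * s ^ 2) * (1 - l) + s ^ 2)) /
        (4 * (1 + s) ^ 2) := by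
    field_simp
    ring
  rw [← sub_nonneg, hdiff]
  positivity

variable {E : Type*} [NormedAddCommGroup E] [InnerProductSpace ℝ E]

lemma momentum_energy_eq {η l : ℝ} {a : ℕ → E} (h01 : a 1 = a 0)
    (hrec : ∀ k, a (k + 2) = (1 + η) • l • a (k + 1) - η • a k) (k : ℕ) :
    ‖a (k + 1)‖ ^ 2 - (1 + η) * l * inner ℝ (a k) (a (k + 1)) + η * ‖a k‖ ^ 2 =
      η ^ k * ((1 + η) * (1 - l) * ‖a 0‖ ^ 2) := by
  induction k with
  | zero =>
    rw [zero_add, h01, real_inner_self_eq_norm_sq]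
    ring
  | succ k ih =>
    rw [hrec k, pow_succ' η, mul_assoc η, ← ih]
    simp only [← real_inner_self_eq_norm_sq, inner_sub_left, inner_sub_right, inner_smul_left,
      inner_smul_right, RCLike.conj_to_real, real_inner_comm (a k) (a (k + 1))]
    ring

lemma momentum_norm_sq_le {η l : ℝ} {a : ℕ → E} (h01 : a 1 = a 0)
    (hrec : ∀ k, a (k + 2) = (1 + η) • l • a (k + 1) - η • a k) (k : ℕ) :
    (η - (1 + η) ^ 2 * l ^ 2 / 4) * ‖a k‖ ^ 2 ≤ η ^ k * ((1 + η) * (1 - l) * ‖a 0‖ ^ 2) := by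
  have hsquare : 0 ≤ ‖a (k + 1) - ((1 + η) * l / 2) • a k‖ ^ 2 := sq_nonneg _
  rw [norm_sub_sq_real, real_inner_smul_right, norm_smul, mul_pow, Real.norm_eq_abs, sq_abs,
    real_inner_comm] at hsquare
  linarith [momentum_energy_eq h01 hrec k]

lemma mixEta_momentum_decay {l l₂ : ℝ} (h0 : 0 ≤ l) (hl : l ≤ l₂) (h1 : l₂ < 1) {a : ℕ → E}
    (h01 : a 1 = a 0)
    (hrec : ∀ k, a (k + 2) = (1 + mixEta l₂) • l • a (k + 1) - mixEta l₂ • a k)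
    {c : ℝ} {K : ℕ} (hK : c / √(1 - l₂) ≤ (K : ℝ)) :
    ‖a K‖ ^ 2 ≤ 3 * (2 : ℝ) ^ (-c) * ‖a 0‖ ^ 2 := by
  have henergy := momentum_norm_sq_le h01 hrec K
  have hdisc := mixEta_discriminant_ge h0 hl h1.le
  have hpow := mixEta_pow_le (h0.trans hl) h1 hK
  set η := mixEta l₂
  have hη : 0 < η := mixEta_pos _
  have hl1 : 0 < 1 - l := by linarith
  refine le_of_mul_le_mul_left ?_ (by positivity : 0 < (1 + η) * (1 - l))
  calc (1 + η) * (1 - l) * ‖a K‖ ^ 2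
      ≤ 3 * (η - (1 + η) ^ 2 * l ^ 2 / 4) * ‖a K‖ ^ 2 := by gcongr
    _ ≤ 3 * (η ^ K * ((1 + η) * (1 - l) * ‖a 0‖ ^ 2)) := by linarith
    _ ≤ 3 * ((2 : ℝ) ^ (-c) * ((1 + η) * (1 - l) * ‖a 0‖ ^ 2)) := by gcongr
    _ = (1 + η) * (1 - l) * (3 * (2 : ℝ) ^ (-c) * ‖a 0‖ ^ 2) := by ring

end Momentum

namespace Agents

variable {m d : ℕ}

section Average

lemma smul_avg (x : Agents m d) : (m : ℝ) • avg x = ∑ i, x i := by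
  rcases m.eq_zero_or_pos with rfl | hm
  · simp
  · rw [avg, smul_smul, mul_one_div_cancel (by positivity), one_smul]

lemma avg_add (x y : Agents m d) : avg (x + y) = avg x + avg y := by
  simp only [avg, Pi.add_apply, Finset.sum_add_distrib, smul_add]

lemma avg_sub (x y : Agents m d) : avg (x - y) = avg x - avg y := by
  simp only [avg, Pi.sub_apply, Finset.sum_sub_distrib, smul_sub]

lemma avg_smul (c : ℝ) (x : Agents m d) : avg (c • x) = c • avg x := by
  simp only [avg, Pi.smul_apply, ← Finset.smul_sum, smul_comm c]

lemma avg_const (hm : 0 < m) (v : EuclideanSpace ℝ (Fin d)) : avg (const m v) = v := by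
  simp only [avg, const, Finset.sum_const, Finset.card_univ, Fintype.card_fin,
    ← Nat.cast_smul_eq_nsmul ℝ, smul_smul]
  rw [one_div_mul_cancel (by positivity), one_smul]

lemma mul_apply_avg_le {R : EuclideanSpace ℝ (Fin d) → ℝ} (hR : ConvexOn ℝ Set.univ R)
    (x : Agents m d) : m * R (avg x) ≤ ∑ i, R (x i) := by
  rcases m.eq_zero_or_pos with rfl | hm
  · simp
  have hm' : (0 : ℝ) < m := by positivity
  have h := hR.map_sum_le (t := Finset.univ) (w := fun _ : Fin m => 1 / (m : ℝ)) (p := x)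
    (fun _ _ => by positivity) (by simp [hm'.ne']) (fun _ _ => Set.mem_univ _)
  rw [← Finset.smul_sum, ← Finset.smul_sum, smul_eq_mul] at h
  rwa [one_div, le_inv_mul_iff₀ hm', ← one_div] at h

end Average

section Disagreement

/-- The matrix `Π x` of the deviations of the rows from their average. -/
noncomputable def dev (x : Agents m d) : Agents m d := fun i => x i - avg x

/-- The consensus error `‖Π x‖²`. -/
noncomputable def disagreement (x : Agents m d) : ℝ := normSq (dev x)

lemma leftMul_consensusProj (x : Agents m d) : leftMul (consensusProj m) x = dev x := by
  funext i
  simp only [leftMul, consensusProj, dev, avg, Matrix.sub_apply, Matrix.smul_apply,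
    Matrix.of_apply, Matrix.one_apply, sub_smul, Finset.sum_sub_distrib, ite_smul, one_smul,
    zero_smul, Finset.sum_ite_eq, Finset.mem_univ, if_true, Finset.smul_sum, smul_eq_mul, mul_one]

lemma dev_add (x y : Agents m d) : dev (x + y) = dev x + dev y := by
  funext i
  simp only [dev, avg_add, Pi.add_apply]
  abel

lemma dev_smul (c : ℝ) (x : Agents m d) : dev (c • x) = c • dev x := by
  funext i
  simp only [dev, avg_smul, Pi.smul_apply, smul_sub]

lemma sum_dev (x : Agents m d) : ∑ i, dev x i = 0 := by
  simp only [dev, Finset.sum_sub_distrib, Finset.sum_const, Finset.card_univ, Fintype.card_fin,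
    ← Nat.cast_smul_eq_nsmul ℝ, smul_avg, sub_self]

lemma normSq_nonneg (x : Agents m d) : 0 ≤ normSq x := by
  unfold normSq
  positivity

lemma normSq_add_le (x y : Agents m d) : normSq (x + y) ≤ 2 * normSq x + 2 * normSq y := by
  simp only [normSq, Finset.mul_sum, ← Finset.sum_add_distrib]
  refine Finset.sum_le_sum fun i _ => ?_
  calc ‖x i + y i‖ ^ 2 ≤ (‖x i‖ + ‖y i‖) ^ 2 := by gcongr; exact norm_add_le _ _
    _ ≤ 2 * ‖x i‖ ^ 2 + 2 * ‖y i‖ ^ 2 := by rw [← mul_add]; exact add_sq_le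

lemma disagreement_nonneg (x : Agents m d) : 0 ≤ disagreement x := normSq_nonneg _

lemma disagreement_const (v : EuclideanSpace ℝ (Fin d)) : disagreement (const m v) = 0 := by
  rw [disagreement, normSq]
  refine Finset.sum_eq_zero fun i _ => ?_
  rw [dev, avg_const i.pos, const, sub_self, norm_zero, zero_pow two_ne_zero]

lemma disagreement_add_le (x y : Agents m d) :
    disagreement (x + y) ≤ 2 * disagreement x + 2 * disagreement y := by
  rw [disagreement, dev_add]
  exact normSq_add_le _ _

lemma disagreement_smul (c : ℝ) (x : Agents m d) :
    disagreement (c • x) = c ^ 2 * disagreement x := by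
  simp only [disagreement, normSq, dev_smul, Pi.smul_apply, norm_smul, mul_pow, Real.norm_eq_abs,
    sq_abs, Finset.mul_sum]

lemma normSq_sub_const (x : Agents m d) (v : EuclideanSpace ℝ (Fin d)) :
    normSq (x - const m v) = disagreement x + m * ‖avg x - v‖ ^ 2 := by
  have hrow (i : Fin m) : ‖(x - const m v) i‖ ^ 2 =
      ‖dev x i‖ ^ 2 + 2 * inner ℝ (dev x i) (avg x - v) + ‖avg x - v‖ ^ 2 := by
    rw [← norm_add_sq_real, dev, sub_add_sub_cancel, Pi.sub_apply, const]
  simp only [normSq, disagreement, hrow, Finset.sum_add_distrib, ← Finset.mul_sum, ← sum_inner,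
    sum_dev, inner_zero_left, Finset.sum_const, Finset.card_univ, Fintype.card_fin, nsmul_eq_mul]
  ring

lemma normSq_eq (x : Agents m d) : normSq x = disagreement x + m * ‖avg x‖ ^ 2 := by
  have h := normSq_sub_const x 0
  rwa [show const m 0 = (0 : Agents m d) from rfl, sub_zero, sub_zero] at h

lemma disagreement_le_normSq (x : Agents m d) : disagreement x ≤ normSq x := by
  rw [normSq_eq]
  exact le_add_of_nonneg_right (by positivity)

lemma mul_norm_avg_sub_sq_le (x y : Agents m d) :
    m * ‖avg x - avg y‖ ^ 2 ≤ normSq (x - y) := by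
  rw [normSq_eq, avg_sub]
  exact le_add_of_nonneg_left (disagreement_nonneg _)

lemma sum_inner_sub (s x : Agents m d) (v : EuclideanSpace ℝ (Fin d)) :
    ∑ i, inner ℝ (s i) (x i - v) =
      m * inner ℝ (avg s) (avg x - v) + ∑ i, inner ℝ (dev s i) (dev x i) := by
  have hrow (i : Fin m) : inner ℝ (s i) (x i - v) =
      inner ℝ (avg s) (dev x i) + inner ℝ (s i) (avg x - v) + inner ℝ (dev s i) (dev x i) := by
    simp only [dev, inner_sub_left, inner_sub_right]
    ring
  simp only [hrow, Finset.sum_add_distrib, ← inner_sum, ← sum_inner, sum_dev, inner_zero_right,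
    ← smul_avg s, real_inner_smul_left, zero_add]

lemma neg_inner_dev_le (s x : Agents m d) {a b : ℝ} (ha : 0 < a) (hab : 1 ≤ 4 * a * b) :
    -∑ i, inner ℝ (dev s i) (dev x i) ≤ a * disagreement x + b * disagreement s := by
  simp only [disagreement, normSq, Finset.mul_sum, ← Finset.sum_add_distrib,
    ← Finset.sum_neg_distrib]
  refine Finset.sum_le_sum fun i _ => ?_
  have hcs := neg_le_of_abs_le (abs_real_inner_le_norm (dev s i) (dev x i))
  have hyoung : 0 ≤ 4 * a * (a * ‖dev x i‖ ^ 2 + b * ‖dev s i‖ ^ 2 - ‖dev s i‖ * ‖dev x i‖) := by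
    nlinarith [sq_nonneg (2 * a * ‖dev x i‖ - ‖dev s i‖), sq_nonneg ‖dev s i‖]
  linarith [nonneg_of_mul_nonneg_right hyoung (by positivity)]

end Disagreement

end Agents

section RowCombinations

variable {m d : ℕ} {W : Matrix (Fin m) (Fin m) ℝ}

namespace Agents

/-- The linear combination `uᵀ x` of the rows; for an eigenvector `u` of the weight matrix it is
one coordinate of `x` in which gossip acts as multiplication by a scalar. -/
noncomputable def rowComb (u : Fin m → ℝ) (x : Agents m d) : EuclideanSpace ℝ (Fin d) :=
  ∑ i, u i • x i

lemma rowComb_sub (u : Fin m → ℝ) (x y : Agents m d) :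
    rowComb u (x - y) = rowComb u x - rowComb u y := by
  simp only [rowComb, Pi.sub_apply, smul_sub, Finset.sum_sub_distrib]

lemma rowComb_smul (u : Fin m → ℝ) (c : ℝ) (x : Agents m d) :
    rowComb u (c • x) = c • rowComb u x := by
  simp only [rowComb, Pi.smul_apply, Finset.smul_sum, smul_comm c]

lemma rowComb_leftMul (hW : W.IsHermitian) {u : Fin m → ℝ} {l : ℝ}
    (hu : W.mulVec u = l • u) (x : Agents m d) : rowComb u (leftMul W x) = l • rowComb u x := by
  have hcol (j : Fin m) : l * u j = ∑ i, u i * W i j := by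
    rw [← smul_eq_mul, ← Pi.smul_apply, ← hu, Matrix.mulVec, dotProduct]
    refine Finset.sum_congr rfl fun i _ => ?_
    rw [mul_comm, ← hW.apply j i, star_trivial]
  simp only [rowComb, leftMul, Finset.smul_sum, smul_smul, hcol, Finset.sum_smul]
  exact Finset.sum_comm

lemma rowComb_dev_of_const {u : Fin m → ℝ} {c : ℝ} (hu : u = fun _ => c) (x : Agents m d) :
    rowComb u (dev x) = 0 := by
  simp only [rowComb, hu, ← Finset.smul_sum, sum_dev, smul_zero]

lemma rowComb_dev_of_sum_eq_zero {u : Fin m → ℝ} (hu : ∑ i, u i = 0) (x : Agents m d) :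
    rowComb u (dev x) = rowComb u x := by
  simp only [rowComb, dev, smul_sub, Finset.sum_sub_distrib, ← Finset.sum_smul, hu, zero_smul,
    sub_zero]

lemma sum_norm_rowComb_sq (b : OrthonormalBasis (Fin m) ℝ (EuclideanSpace ℝ (Fin m)))
    (x : Agents m d) : ∑ j, ‖rowComb (b j) x‖ ^ 2 = normSq x := by
  have parseval (k : Fin d) : ∑ j, (rowComb (b j) x k) ^ 2 = ∑ i, (x i k) ^ 2 := by
    have h := b.sum_sq_norm_inner_right (WithLp.toLp 2 fun i => x i k)
    rw [EuclideanSpace.real_norm_sq_eq] at h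
    rw [← h]
    refine Finset.sum_congr rfl fun j _ => ?_
    rw [Real.norm_eq_abs, sq_abs]
    simp [rowComb, PiLp.inner_apply, mul_comm]
  simp only [normSq, EuclideanSpace.real_norm_sq_eq]
  rw [Finset.sum_comm, Finset.sum_congr rfl fun k _ => parseval k, Finset.sum_comm]

end Agents

open Agents

lemma rowComb_fastMixSeq (hW : W.IsHermitian) {u : Fin m → ℝ} {l : ℝ}
    (hu : W.mulVec u = l • u) (η : ℝ) (x : Agents m d) (k : ℕ) :
    rowComb u (fastMixSeq W η x (k + 2)) =
      (1 + η) • l • rowComb u (fastMixSeq W η x (k + 1)) - η • rowComb u (fastMixSeq W η x k) := by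
  rw [fastMixSeq, rowComb_sub, rowComb_smul, rowComb_smul, rowComb_leftMul hW hu]

lemma rowComb_fastMixSeq_of_fixed (hW : W.IsHermitian) {u : Fin m → ℝ} (hu : W.mulVec u = u)
    (η : ℝ) (x : Agents m d) (k : ℕ) : rowComb u (fastMixSeq W η x k) = rowComb u x := by
  induction k using Nat.twoStepInduction with
  | zero => rfl
  | one => rfl
  | more k ih₀ ih₁ =>
    rw [rowComb_fastMixSeq (l := 1) hW (by rw [hu, one_smul]), ih₀, ih₁]
    module

lemma avg_fastMix (hW : W.IsHermitian) (h1 : W.mulVec (fun _ => 1) = fun _ => 1) (η : ℝ)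
    (K : ℕ) (x : Agents m d) : avg (fastMix W η K x) = avg x := by
  have h := rowComb_fastMixSeq_of_fixed hW h1 η x K
  rw [avg, avg, fastMix]
  simpa only [rowComb, one_smul] using congrArg ((1 / (m : ℝ)) • ·) h

end RowCombinations

section SpectralGap

variable {m : ℕ} {G : SimpleGraph (Fin m)} {W : Matrix (Fin m) (Fin m) ℝ}

lemma sum_eq_zero_of_mulVec_eq_smul (hW : W.IsHermitian)
    (h1 : W.mulVec (fun _ => 1) = fun _ => 1) {u : Fin m → ℝ} {l : ℝ} (hu : W.mulVec u = l • u)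
    (hl : l ≠ 1) : ∑ i, u i = 0 := by
  have hsum : (fun _ => 1) ⬝ᵥ u = l * ((fun _ => 1) ⬝ᵥ u) := by
    rw [← smul_eq_mul, ← dotProduct_smul, ← hu, Matrix.dotProduct_mulVec, ← Matrix.mulVec_transpose,
      ← Matrix.conjTranspose_eq_transpose_of_trivial, hW.eq, h1]
  have hne : (1 - l) * ∑ i, u i = 0 := by
    simp only [dotProduct, one_mul] at hsum
    linarith
  exact (mul_eq_zero.mp hne).resolve_left (sub_ne_zero.mpr hl.symm)

lemma exists_eigenvalues_eq_lambda2 (hW : W.IsHermitian) (hm : 2 ≤ m) :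
    ∃ j₀ j₁ : Fin m, j₀ ≠ j₁ ∧ hW.eigenvalues j₁ = lambda2 hW hm ∧
      lambda2 hW hm ≤ hW.eigenvalues j₀ ∧ ∀ j ≠ j₀, hW.eigenvalues j ≤ lambda2 hW hm := by
  set e : Fin (Fintype.card (Fin m)) ≃ Fin m := Fintype.equivOfCardEq (Fintype.card_fin _) with he
  have heig (k) : hW.eigenvalues (e k) = hW.eigenvalues₀ k := by
    simp [Matrix.IsHermitian.eigenvalues, he]
  have hcard : 2 ≤ Fintype.card (Fin m) := by rwa [Fintype.card_fin]
  refine ⟨e ⟨0, by omega⟩, e ⟨1, by omega⟩, by simp, heig _, ?_, fun j hj => ?_⟩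
  · rw [heig]
    exact hW.eigenvalues₀_antitone (Fin.mk_le_of_le_val (Nat.zero_le _))
  · obtain ⟨k, rfl⟩ := e.surjective j
    rw [heig]
    refine hW.eigenvalues₀_antitone (Fin.mk_le_of_le_val (Nat.one_le_iff_ne_zero.mpr ?_))
    exact fun hk => hj (congrArg e (Fin.ext hk))

namespace IsWeightMatrix

lemma isHermitian (hW : IsWeightMatrix G W) : W.IsHermitian := hW.posSemidef.isHermitian

lemma eigenvalues_le_one (hW : IsWeightMatrix G W) (j : Fin m) :
    hW.isHermitian.eigenvalues j ≤ 1 := by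
  have hnorm := EuclideanSpace.real_norm_sq_eq (hW.isHermitian.eigenvectorBasis j)
  have h := hW.le_one.dotProduct_mulVec_nonneg (hW.isHermitian.eigenvectorBasis j)
  rw [hW.isHermitian.eigenvectorBasis.norm_eq_one, one_pow] at hnorm
  rw [Matrix.sub_mulVec, Matrix.one_mulVec, hW.isHermitian.mulVec_eigenvectorBasis,
    dotProduct_sub, dotProduct_smul, star_trivial, dotProduct] at h
  simp only [← sq, ← hnorm, smul_eq_mul, mul_one] at h
  linarith

lemma eigenvector_eq_const (hW : IsWeightMatrix G W) {j : Fin m}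
    (hj : hW.isHermitian.eigenvalues j = 1) :
    ∃ c : ℝ, ⇑(hW.isHermitian.eigenvectorBasis j) = fun _ => c := by
  have hker : ⇑(hW.isHermitian.eigenvectorBasis j) ∈ LinearMap.ker (Matrix.toLin' (1 - W)) := by
    rw [LinearMap.mem_ker, Matrix.toLin'_apply, Matrix.sub_mulVec, Matrix.one_mulVec,
      hW.isHermitian.mulVec_eigenvectorBasis, hj, one_smul, sub_self]
  rw [hW.null, Submodule.mem_span_singleton] at hker
  obtain ⟨c, hc⟩ := hker
  exact ⟨c, by rw [← hc]; funext; simp⟩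

lemma eq_of_eigenvalues_eq_one (hW : IsWeightMatrix G W) {i j : Fin m}
    (hi : hW.isHermitian.eigenvalues i = 1) (hj : hW.isHermitian.eigenvalues j = 1) : i = j := by
  obtain ⟨c, hc⟩ := hW.eigenvector_eq_const hi
  obtain ⟨c', hc'⟩ := hW.eigenvector_eq_const hj
  have hon := orthonormal_iff_ite.mp hW.isHermitian.eigenvectorBasis.orthonormal
  have hii := hon i i
  have hjj := hon j j
  have hij := hon i j
  simp only [PiLp.inner_apply, hc, hc', RCLike.inner_apply, RCLike.conj_to_real, Finset.sum_const,
    Finset.card_univ, Fintype.card_fin, nsmul_eq_mul, if_true] at hii hjj hij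
  by_contra hne
  rw [if_neg hne] at hij
  have : (m * (c * c)) * (m * (c' * c')) = (m * (c' * c)) ^ 2 := by ring
  rw [hii, hjj, hij] at this
  norm_num at this

lemma exists_eigenvalues_eq_one (hW : IsWeightMatrix G W) (hm : 0 < m) :
    ∃ j, hW.isHermitian.eigenvalues j = 1 := by
  have hvec : Module.End.HasEigenvector (Matrix.toLin' W) 1 (fun _ => (1 : ℝ)) := by
    refine ⟨Module.End.mem_eigenspace_iff.mpr ?_, fun h => one_ne_zero (congrFun h ⟨0, hm⟩)⟩
    rw [Matrix.toLin'_apply, hW.mulVec_one, one_smul]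
  have hmem := (Module.End.hasEigenvalue_of_hasEigenvector hvec).mem_spectrum
  rwa [Matrix.spectrum_toLin', hW.isHermitian.spectrum_real_eq_range_eigenvalues] at hmem

lemma lambda2_lt_one (hW : IsWeightMatrix G W) (hm : 2 ≤ m) : lambda2 hW.isHermitian hm < 1 := by
  obtain ⟨j₀, j₁, hne, heq, hle, -⟩ := exists_eigenvalues_eq_lambda2 hW.isHermitian hm
  refine (heq ▸ hW.eigenvalues_le_one j₁).lt_of_ne fun h1 => hne ?_
  exact hW.eq_of_eigenvalues_eq_one
    ((hW.eigenvalues_le_one j₀).antisymm (h1 ▸ hle)) (heq.trans h1)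

lemma eigenvalues_le_lambda2 (hW : IsWeightMatrix G W) (hm : 2 ≤ m) {j : Fin m}
    (hj : hW.isHermitian.eigenvalues j ≠ 1) :
    hW.isHermitian.eigenvalues j ≤ lambda2 hW.isHermitian hm := by
  obtain ⟨j₀, -, -, -, -, hle⟩ := exists_eigenvalues_eq_lambda2 hW.isHermitian hm
  obtain ⟨i, hi⟩ := hW.exists_eigenvalues_eq_one (by omega)
  have hij₀ : i = j₀ := by
    by_contra hne
    exact absurd (hi ▸ hle i hne) (hW.lambda2_lt_one hm).not_ge
  exact hle j fun h => hj (by rw [h, ← hij₀, hi])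

end IsWeightMatrix

end SpectralGap

section Consensus

open Agents

variable {m d : ℕ}

/-- A communication procedure `mix` that preserves the average of the local copies and shrinks
their squared consensus error by the factor `δ`; all that the optimization algorithm needs to know
about the network. -/
structure IsConsensusContraction (δ : ℝ) (mix : Agents m d → Agents m d) : Prop where
  avg_eq (x : Agents m d) : avg (mix x) = avg x
  disagreement_le (x : Agents m d) : disagreement (mix x) ≤ δ * disagreement x

lemma IsConsensusContraction.mono {δ δ' : ℝ} {mix : Agents m d → Agents m d}
    (h : IsConsensusContraction δ mix) (hδ : δ ≤ δ') : IsConsensusContraction δ' mix where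
  avg_eq := h.avg_eq
  disagreement_le x := (h.disagreement_le x).trans (by gcongr; exact disagreement_nonneg x)

theorem IsWeightMatrix.isConsensusContraction_fastMix {G : SimpleGraph (Fin m)}
    {W : Matrix (Fin m) (Fin m) ℝ} (hW : IsWeightMatrix G W) (hm : 2 ≤ m) {lam : ℝ}
    (hlam : lam = lambda2 hW.isHermitian hm) {c : ℝ} {K : ℕ} (hK : c / √(1 - lam) ≤ (K : ℝ)) :
    IsConsensusContraction (3 * (2 : ℝ) ^ (-c))
      (fastMix W (mixEta lam) K : Agents m d → Agents m d) where
  avg_eq := avg_fastMix hW.isHermitian hW.mulVec_one _ K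
  disagreement_le x := by
    set b := hW.isHermitian.eigenvectorBasis
    rw [disagreement, disagreement, ← sum_norm_rowComb_sq b, ← sum_norm_rowComb_sq b,
      Finset.mul_sum]
    refine Finset.sum_le_sum fun j _ => ?_
    by_cases hj : hW.isHermitian.eigenvalues j = 1
    · obtain ⟨a, ha⟩ := hW.eigenvector_eq_const hj
      rw [rowComb_dev_of_const ha, rowComb_dev_of_const ha, norm_zero, zero_pow two_ne_zero,
        mul_zero]
    · have hmul := hW.isHermitian.mulVec_eigenvectorBasis j
      have hsum := sum_eq_zero_of_mulVec_eq_smul hW.isHermitian hW.mulVec_one hmul hj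
      rw [rowComb_dev_of_sum_eq_zero hsum, rowComb_dev_of_sum_eq_zero hsum]
      exact mixEta_momentum_decay (a := fun k => rowComb (b j) (fastMixSeq W (mixEta lam) x k))
        (hW.posSemidef.eigenvalues_nonneg j) (hlam ▸ hW.eigenvalues_le_lambda2 hm hj)
        (hlam ▸ hW.lambda2_lt_one hm) rfl (rowComb_fastMixSeq hW.isHermitian hmul _ x) hK

end Consensus

section StrongConvexity

open Filter Topology

variable {E : Type*} [NormedAddCommGroup E] [NormedSpace ℝ E] {φ : E → ℝ}

lemma add_norm_sub_sq_le_of_isMinOn {k : ℝ} (hφ : StrongConvexOn Set.univ k φ) {w : E}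
    (hw : IsMinOn φ Set.univ w) (u : E) : φ w + k / 2 * ‖u - w‖ ^ 2 ≤ φ u := by
  have hsegment {t : ℝ} (ht : t ∈ Set.Ioo (0 : ℝ) 1) :
      0 ≤ φ u - φ w - (1 - t) * (k / 2 * ‖u - w‖ ^ 2) := by
    have hconv := hφ.2 (Set.mem_univ w) (Set.mem_univ u) (sub_nonneg.mpr ht.2.le) ht.1.le
      (sub_add_cancel 1 t)
    have hmin : φ w ≤ φ ((1 - t) • w + t • u) := hw (Set.mem_univ _)
    rw [norm_sub_rev w u] at hconv
    simp only [smul_eq_mul] at hconv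
    refine nonneg_of_mul_nonneg_right ?_ ht.1
    linarith
  have hlim : Tendsto (fun t : ℝ => φ u - φ w - (1 - t) * (k / 2 * ‖u - w‖ ^ 2)) (𝓝[>] 0)
      (𝓝 (φ u - φ w - (1 - 0) * (k / 2 * ‖u - w‖ ^ 2))) :=
    (Continuous.tendsto (by fun_prop) 0).mono_left nhdsWithin_le_nhds
  have hnonneg := ge_of_tendsto hlim <| by
    filter_upwards [Ioo_mem_nhdsGT (zero_lt_one' ℝ)] with t ht using hsegment ht
  linarith

lemma add_fderiv_sub_le_of_convexOn (hφ : ConvexOn ℝ Set.univ φ) {x : E} {φ' : E →L[ℝ] ℝ}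
    (hd : HasFDerivAt φ φ' x) (u : E) : φ x + φ' (u - x) ≤ φ u := by
  have hline : ConvexOn ℝ Set.univ (φ ∘ AffineMap.lineMap (k := ℝ) x u) :=
    hφ.comp_affineMap (AffineMap.lineMap x u)
  have hderiv : HasDerivAt (φ ∘ AffineMap.lineMap (k := ℝ) x u) (φ' (u - x)) 0 :=
    HasFDerivAt.comp_hasDerivAt (0 : ℝ) (by rwa [AffineMap.lineMap_apply_zero])
      AffineMap.hasDerivAt_lineMap
  have hslope := hline.le_slope_of_hasDerivAt (Set.mem_univ _) (Set.mem_univ _) one_pos hderiv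
  simp only [slope, sub_zero, inv_one, one_smul, Function.comp_apply, vsub_eq_sub,
    AffineMap.lineMap_apply_one, AffineMap.lineMap_apply_zero] at hslope
  linarith

lemma exists_isMinOn_of_strongConvexOn [FiniteDimensional ℝ E] {k : ℝ} (hk : 0 < k)
    (hφ : StrongConvexOn Set.univ k φ) : ∃ w, IsMinOn φ Set.univ w := by
  have := FiniteDimensional.proper_real E
  have hconvex : ConvexOn ℝ Set.univ φ := hφ.convexOn (fun r => by positivity)
  have hcont : Continuous φ := continuousOn_univ.mp (hconvex.continuousOn isOpen_univ)
  obtain ⟨b, hb⟩ := ((isCompact_closedBall (0 : E) 1).image hcont).bddBelow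
  replace hb {x : E} (hx : ‖x‖ ≤ 1) : b ≤ φ x := hb ⟨x, mem_closedBall_zero_iff.mpr hx, rfl⟩
  have hsublevel {x : E} (hx : φ x ≤ φ 0) : ‖x‖ ≤ 1 + 2 / k * (φ 0 - b) := by
    have hb0 : 0 ≤ 2 / k * (φ 0 - b) := mul_nonneg (by positivity) (sub_nonneg.mpr (hb (by simp)))
    rcases le_or_gt ‖x‖ 1 with hle | hgt
    · linarith
    have hpos : 0 < ‖x‖ := one_pos.trans hgt
    have hinv : ‖x‖⁻¹ ≤ 1 := inv_le_one_of_one_le₀ hgt.le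
    have hunit : b ≤ φ (‖x‖⁻¹ • x) := hb (norm_smul_inv_norm (𝕜 := ℝ) (norm_pos_iff.mp hpos)).le
    have hconv := hφ.2 (Set.mem_univ 0) (Set.mem_univ x) (sub_nonneg.mpr hinv) (by positivity)
      (sub_add_cancel 1 ‖x‖⁻¹)
    simp only [smul_zero, zero_add, smul_eq_mul, zero_sub, norm_neg] at hconv
    have hquad : (1 - ‖x‖⁻¹) * ‖x‖⁻¹ * (k / 2 * ‖x‖ ^ 2) = k / 2 * (‖x‖ - 1) := by
      field_simp
    have hval : ‖x‖⁻¹ * φ x ≤ ‖x‖⁻¹ * φ 0 := by gcongr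
    have hgrowth : k / 2 * (‖x‖ - 1) ≤ φ 0 - b := by linarith
    rw [div_mul_eq_mul_div, div_le_iff₀ two_pos] at hgrowth
    rw [← sub_le_iff_le_add', div_mul_eq_mul_div, le_div_iff₀ hk]
    linarith
  obtain ⟨w, hw⟩ := hcont.exists_forall_le_of_isBounded 0
    ((Metric.isBounded_closedBall (x := (0 : E)) (r := 1 + 2 / k * (φ 0 - b))).subset
      fun x hx => mem_closedBall_zero_iff.mpr (hsublevel hx))
  exact ⟨w, fun u _ => hw u⟩

end StrongConvexity

section ConvexSmooth

variable {E : Type*} [NormedAddCommGroup E] [InnerProductSpace ℝ E]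

/-- `φ` is convex and `h`-smooth with gradient `D`, expressed by the affine lower bound and the
quadratic upper bound at each point. -/
structure IsConvexSmooth (h : ℝ) (φ : E → ℝ) (D : E → E) : Prop where
  lower (x u : E) : φ x + inner ℝ (D x) (u - x) ≤ φ u
  upper (x u : E) : φ u ≤ φ x + inner ℝ (D x) (u - x) + h / 2 * ‖u - x‖ ^ 2

namespace IsConvexSmooth

variable {h : ℝ} {φ : E → ℝ} {D : E → E}

-- Compare both bounds at the gradient step `u - (D u - D x) / h`.
lemma add_norm_sub_sq_le (hφ : IsConvexSmooth h φ D) (hh : 0 < h) (x u : E) :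
    φ x + inner ℝ (D x) (u - x) + 1 / (2 * h) * ‖D u - D x‖ ^ 2 ≤ φ u := by
  have hlower := hφ.lower x (u - (1 / h) • (D u - D x))
  have hupper := hφ.upper u (u - (1 / h) • (D u - D x))
  have hinner : inner ℝ (D u) (D u - D x) - inner ℝ (D x) (D u - D x) = ‖D u - D x‖ ^ 2 := by
    rw [← inner_sub_left, real_inner_self_eq_norm_sq]
  rw [sub_sub_cancel_left, inner_neg_right, inner_smul_right, norm_neg, norm_smul, mul_pow,
    Real.norm_eq_abs, sq_abs] at hupper
  rw [sub_right_comm, inner_sub_right, inner_smul_right] at hlower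
  have hquad : h / 2 * ((1 / h) ^ 2 * ‖D u - D x‖ ^ 2) =
      1 / h * ‖D u - D x‖ ^ 2 - 1 / (2 * h) * ‖D u - D x‖ ^ 2 := by
    field_simp
    ring
  rw [hquad, ← hinner] at hupper
  rw [← hinner]
  linarith

lemma norm_sub_sq_le (hφ : IsConvexSmooth h φ D) (hh : 0 < h) (x u : E) :
    ‖D u - D x‖ ^ 2 ≤ h ^ 2 * ‖u - x‖ ^ 2 := by
  have hxu := hφ.add_norm_sub_sq_le hh x u
  have hux := hφ.add_norm_sub_sq_le hh u x
  rw [← neg_sub u x, inner_neg_right, norm_sub_rev (D x)] at hux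
  have hcs := real_inner_le_norm (D u - D x) (u - x)
  rw [inner_sub_left] at hcs
  have hhalf : 1 / (2 * h) * ‖D u - D x‖ ^ 2 = 1 / h * ‖D u - D x‖ ^ 2 / 2 := by
    field_simp
  have hcocoercive : 1 / h * ‖D u - D x‖ ^ 2 ≤ ‖D u - D x‖ * ‖u - x‖ := by linarith
  rw [one_div, inv_mul_le_iff₀ hh] at hcocoercive
  nlinarith [sq_nonneg (‖D u - D x‖ - h * ‖u - x‖)]

lemma apply_le_convexCombination (hφ : IsConvexSmooth h φ D) (hh : 0 < h) {τ : ℝ} (h0 : 0 ≤ τ)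
    (h1 : τ ≤ 1) (x v u₁ u₂ : E) :
    φ v ≤ τ * φ u₁ + (1 - τ) * φ u₂ + inner ℝ (D x) (v - (τ • u₁ + (1 - τ) • u₂)) +
      h / 2 * ‖v - x‖ ^ 2 - (1 - τ) * (1 / (2 * h) * ‖D x - D u₂‖ ^ 2) := by
  have hv := hφ.upper x v
  have hu₁ := mul_le_mul_of_nonneg_left (hφ.lower x u₁) h0
  have hu₂ := mul_le_mul_of_nonneg_left (hφ.add_norm_sub_sq_le hh x u₂) (sub_nonneg.mpr h1)
  rw [norm_sub_rev (D u₂)] at hu₂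
  simp only [inner_sub_right, inner_add_right, inner_smul_right] at hv hu₁ hu₂ ⊢
  linarith

end IsConvexSmooth

/-- The function `φ + (c / 2) ‖·‖²`; it moves strong convexity between the smooth and the
nonsmooth part of the objective. -/
noncomputable def quadShift (c : ℝ) (φ : E → ℝ) : E → ℝ := fun u => φ u + c / 2 * ‖u‖ ^ 2

lemma convexOn_quadShift {c : ℝ} (hc : 0 ≤ c) {φ : E → ℝ} (hφ : ConvexOn ℝ Set.univ φ) :
    ConvexOn ℝ Set.univ (quadShift c φ) :=
  hφ.add (((convexOn_norm convex_univ).pow (fun _ _ => norm_nonneg _) 2).smul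
    (by positivity : 0 ≤ c / 2))

end ConvexSmooth

section Prox

variable {d : ℕ} {g : EuclideanSpace ℝ (Fin d) → ℝ}

lemma strongConvexOn_prox_objective (hg : ConvexOn ℝ Set.univ g) {c : ℝ} (hc : 0 ≤ c)
    (v : EuclideanSpace ℝ (Fin d)) :
    StrongConvexOn Set.univ 1 fun u => c * g u + 1 / 2 * ‖u - v‖ ^ 2 := by
  rw [strongConvexOn_iff_convex]
  have hexpand : (fun u => c * g u + 1 / 2 * ‖u - v‖ ^ 2 - 1 / 2 * ‖u‖ ^ 2) =
      (fun u => c • g u) + fun u => (-(innerSL ℝ v)).toLinearMap u + 1 / 2 * ‖v‖ ^ 2 := by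
    funext u
    simp only [Pi.add_apply, smul_eq_mul, ContinuousLinearMap.coe_coe,
      neg_apply, innerSL_apply_apply, norm_sub_sq_real, real_inner_comm u v]
    ring
  rw [hexpand]
  exact (hg.smul hc).add (((-(innerSL ℝ v)).toLinearMap.convexOn convex_univ).add_const _)

lemma isMinOn_prox (hg : ConvexOn ℝ Set.univ g) {c : ℝ} (hc : 0 ≤ c)
    (v : EuclideanSpace ℝ (Fin d)) :
    IsMinOn (fun u => c * g u + 1 / 2 * ‖u - v‖ ^ 2) Set.univ (prox c g v) :=
  Classical.epsilon_spec
    (exists_isMinOn_of_strongConvexOn one_pos (strongConvexOn_prox_objective hg hc v))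

lemma mul_sub_le_inner_prox (hg : ConvexOn ℝ Set.univ g) {c : ℝ} (hc : 0 ≤ c)
    (v u : EuclideanSpace ℝ (Fin d)) :
    c * (g (prox c g v) - g u) ≤ inner ℝ (prox c g v - v) (u - prox c g v) := by
  have hgrowth := add_norm_sub_sq_le_of_isMinOn (strongConvexOn_prox_objective hg hc v)
    (isMinOn_prox hg hc v) u
  have hexpand := norm_add_sq_real (prox c g v - v) (u - prox c g v)
  rw [sub_add_sub_cancel'] at hexpand
  linarith

lemma prox_three_point (hg : ConvexOn ℝ Set.univ g) {μ γ : ℝ} (hμ : 0 ≤ μ) (hγ : 0 ≤ γ)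
    (z s u : EuclideanSpace ℝ (Fin d)) {w : EuclideanSpace ℝ (Fin d)}
    (hw : w = prox (γ / (1 + μ * γ)) g ((1 / (1 + μ * γ)) • (z - γ • s))) :
    γ * (quadShift μ g w - quadShift μ g u) + γ * inner ℝ s (w - u) + 1 / 2 * ‖w - z‖ ^ 2 +
      (1 + μ * γ) / 2 * ‖w - u‖ ^ 2 ≤ 1 / 2 * ‖z - u‖ ^ 2 := by
  have hp : 0 < 1 + μ * γ := by positivity
  have hvar := mul_sub_le_inner_prox hg (by positivity : 0 ≤ γ / (1 + μ * γ))
    ((1 / (1 + μ * γ)) • (z - γ • s)) u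
  rw [← hw] at hvar
  have hscaled : γ * (g w - g u) ≤ inner ℝ ((1 + μ * γ) • w - (z - γ • s)) (u - w) := by
    calc γ * (g w - g u) = (1 + μ * γ) * (γ / (1 + μ * γ) * (g w - g u)) := by field_simp
      _ ≤ (1 + μ * γ) * inner ℝ (w - (1 / (1 + μ * γ)) • (z - γ • s)) (u - w) := by gcongr
      _ = inner ℝ ((1 + μ * γ) • w - (z - γ • s)) (u - w) := by
        rw [← real_inner_smul_left, smul_sub, smul_smul, mul_one_div_cancel hp.ne', one_smul]
  simp only [quadShift, norm_sub_sq_real, inner_sub_left, inner_sub_right, real_inner_smul_left,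
    real_inner_self_eq_norm_sq] at hscaled ⊢
  rw [real_inner_comm z w]
  linarith

end Prox

section Objective

variable {m d : ℕ}

lemma IsLSmooth.isConvexSmooth_quadShift {f : EuclideanSpace ℝ (Fin d) → ℝ} {L μ : ℝ}
    (hsmooth : IsLSmooth L f) (hstrong : StrongConvexOn Set.univ μ f) :
    IsConvexSmooth (L - μ) (quadShift (-μ) f) fun v => gradient f v - μ • v where
  lower x u := by
    have hconvex : ConvexOn ℝ Set.univ (quadShift (-μ) f) := by
      unfold quadShift
      simpa only [neg_div, neg_mul, ← sub_eq_add_neg] using strongConvexOn_iff_convex.mp hstrong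
    have hderiv := (hsmooth.1 x).hasGradientAt.hasFDerivAt.add
      ((hasStrictFDerivAt_norm_sq x).hasFDerivAt.const_mul (-μ / 2))
    have hbound := add_fderiv_sub_le_of_convexOn hconvex hderiv u
    simp only [add_apply, smul_apply, smul_eq_mul,
      InnerProductSpace.toDual_apply_apply, innerSL_apply_apply, nsmul_eq_mul] at hbound
    rw [inner_sub_left, real_inner_smul_left]
    push_cast at hbound
    linarith
  upper x u := by
    have hbound := hsmooth.2 x u
    have hexpand := norm_add_sq_real x (u - x)
    rw [add_sub_cancel] at hexpand
    rw [norm_sub_rev x u] at hbound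
    simp only [quadShift, inner_sub_left, real_inner_smul_left]
    linear_combination hbound - μ / 2 * hexpand

lemma mul_compositeObj (f : Fin m → EuclideanSpace ℝ (Fin d) → ℝ)
    (g : EuclideanSpace ℝ (Fin d) → ℝ) (v : EuclideanSpace ℝ (Fin d)) :
    m * compositeObj f g v = ∑ i, f i v + m * g v := by
  rcases m.eq_zero_or_pos with rfl | hm
  · simp
  rw [compositeObj, mul_add, ← mul_assoc, mul_one_div_cancel (by positivity), one_mul]

lemma compositeObj_quadShift (hm : 0 < m) (c : ℝ) (f : Fin m → EuclideanSpace ℝ (Fin d) → ℝ)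
    (g : EuclideanSpace ℝ (Fin d) → ℝ) :
    compositeObj (fun i => quadShift (-c) (f i)) (quadShift c g) = compositeObj f g := by
  funext v
  simp only [compositeObj, quadShift, Finset.sum_add_distrib, Finset.sum_const, Finset.card_univ,
    Fintype.card_fin, nsmul_eq_mul]
  field_simp
  ring

lemma strongConvexOn_compositeObj (hm : 0 < m) {f : Fin m → EuclideanSpace ℝ (Fin d) → ℝ}
    {g : EuclideanSpace ℝ (Fin d) → ℝ} {μ : ℝ} (hf : ∀ i, StrongConvexOn Set.univ μ (f i))
    (hg : ConvexOn ℝ Set.univ g) : StrongConvexOn Set.univ μ (compositeObj f g) := by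
  have hm' : (0 : ℝ) < m := by positivity
  refine ⟨convex_univ, fun x hx y hy a b ha hb hab => le_of_mul_le_mul_left ?_ hm'⟩
  have hsum := Finset.sum_le_sum fun i (_ : i ∈ Finset.univ) => (hf i).2 hx hy ha hb hab
  have hreg := mul_le_mul_of_nonneg_left (hg.2 hx hy ha hb hab) hm'.le
  simp only [smul_eq_mul, Finset.sum_sub_distrib, Finset.sum_add_distrib, ← Finset.mul_sum,
    Finset.sum_const, Finset.card_univ, Fintype.card_fin, nsmul_eq_mul] at hsum hreg ⊢
  rw [mul_compositeObj]
  linear_combination hsum + hreg - a * mul_compositeObj f g x - b * mul_compositeObj f g y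

end Objective

section StepSize

/-- The relations between the smoothness `h` of the shifted summands and the parameters `μ`, `γ`,
`τ` of the method that its analysis uses; the constants come from `γ = 1 / (20 √(h μ))`. -/
structure IsStepSize (h μ γ τ : ℝ) : Prop where
  mu_pos : 0 < μ
  gamma_pos : 0 < γ
  tau_eq : τ = μ * γ
  tau_le : τ ≤ 1 / 20
  mul_mul_eq : h * γ * τ = 1 / 400

namespace IsStepSize

variable {h μ γ τ : ℝ}

lemma of_eq (hμ : 0 < μ) (hh : μ ≤ h) (hγ : γ = 1 / (20 * √(h * μ))) (hτ : τ = μ * γ) :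
    IsStepSize h μ γ τ := by
  have hh0 : 0 < h := hμ.trans_le hh
  have hhμ : 0 < h * μ := mul_pos hh0 hμ
  have hγ0 : 0 < γ := by rw [hγ]; positivity
  have hprod : h * γ * τ = 1 / 400 := by
    calc h * γ * τ = h * μ * γ ^ 2 := by rw [hτ]; ring
      _ = 1 / 400 := by
        rw [hγ, div_pow, mul_pow, Real.sq_sqrt hhμ.le]
        field_simp
        norm_num
  have hτ0 : 0 < τ := hτ ▸ mul_pos hμ hγ0
  have hsq : τ ^ 2 ≤ (1 / 20) ^ 2 := by
    calc τ ^ 2 = μ * γ * τ := by rw [sq, ← hτ]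
      _ ≤ h * γ * τ := by gcongr
      _ = (1 / 20) ^ 2 := by rw [hprod]; norm_num
  exact ⟨hμ, hγ0, hτ, le_of_sq_le_sq hsq (by norm_num), hprod⟩

variable (hp : IsStepSize h μ γ τ)
include hp

lemma tau_pos : 0 < τ := hp.tau_eq ▸ mul_pos hp.mu_pos hp.gamma_pos

lemma h_pos : 0 < h := by
  have hprod : 0 < h * (γ * τ) := by
    rw [← mul_assoc, hp.mul_mul_eq]
    norm_num
  exact pos_of_mul_pos_left hprod (mul_pos hp.gamma_pos hp.tau_pos).le

lemma mul_tau_sq_eq : h / μ * τ ^ 2 = 1 / 400 := by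
  have := hp.mu_pos
  rw [← hp.mul_mul_eq, hp.tau_eq]
  field_simp

lemma half_tau_eq : τ / 2 = 1 / 40 * √(μ / h) := by
  have hsq : μ / h = (20 * τ) ^ 2 := by
    have := hp.mu_pos
    have := hp.h_pos
    have heq := hp.mul_tau_sq_eq
    field_simp at heq ⊢
    linarith
  have := hp.tau_pos
  rw [hsq, Real.sqrt_sq (by positivity)]
  ring

end IsStepSize

end StepSize

section Round

open Agents

variable {m d : ℕ} {φ : Fin m → EuclideanSpace ℝ (Fin d) → ℝ}
  {D : Fin m → EuclideanSpace ℝ (Fin d) → EuclideanSpace ℝ (Fin d)}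
  {r g : EuclideanSpace ℝ (Fin d) → ℝ} {h μ γ τ : ℝ}

/-- The aggregated gradient: agent `i` evaluates its own gradient `D i` at its own copy `x i`. -/
def gradRows (D : Fin m → EuclideanSpace ℝ (Fin d) → EuclideanSpace ℝ (Fin d))
    (x : Agents m d) : Agents m d := fun i => D i (x i)

/-- The update of the `z`-variable before mixing. -/
noncomputable def proxStep (μ γ : ℝ) (g : EuclideanSpace ℝ (Fin d) → ℝ) (z s : Agents m d) :
    Agents m d :=
  fun i => prox (γ / (1 + μ * γ)) g ((1 / (1 + μ * γ)) • (z i - γ • s i))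

lemma sum_smooth_descent (hφ : ∀ i, IsConvexSmooth h (φ i) (D i)) (hh : 0 < h) (h0 : 0 ≤ τ)
    (h1 : τ ≤ 1) (y z : Agents m d) (w u : EuclideanSpace ℝ (Fin d)) :
    ∑ i, φ i (τ • w + (1 - τ) • avg y) ≤ τ * ∑ i, φ i u + (1 - τ) * ∑ i, φ i (avg y) +
      τ * (m * inner ℝ (avg (gradRows D (τ • z + (1 - τ) • y))) (w - u)) +
      h / 2 * (disagreement (τ • z + (1 - τ) • y) + m * (τ ^ 2 * ‖w - avg z‖ ^ 2)) -
      (1 - τ) * (1 / (2 * h) *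
        normSq (gradRows D (τ • z + (1 - τ) • y) - gradRows D (const m (avg y)))) := by
  set x := τ • z + (1 - τ) • y with hx
  have hsum := Finset.sum_le_sum fun i (_ : i ∈ Finset.univ) =>
    (hφ i).apply_le_convexCombination hh h0 h1 (x i) (τ • w + (1 - τ) • avg y) u (avg y)
  have hdir : τ • w + (1 - τ) • avg y - (τ • u + (1 - τ) • avg y) = τ • (w - u) := by module
  have hinner : ∑ i, inner ℝ (D i (x i)) (w - u) =
      m * inner ℝ (avg (gradRows D x)) (w - u) := by
    rw [← sum_inner, ← real_inner_smul_left, smul_avg]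
    rfl
  have hdist : ∑ i, ‖τ • w + (1 - τ) • avg y - x i‖ ^ 2 =
      disagreement x + m * (τ ^ 2 * ‖w - avg z‖ ^ 2) := by
    have havg : avg x - (τ • w + (1 - τ) • avg y) = τ • (avg z - w) := by
      rw [hx, avg_add, avg_smul, avg_smul]
      module
    simp only [norm_sub_rev (τ • w + (1 - τ) • avg y)]
    refine (normSq_sub_const x _).trans ?_
    rw [havg, norm_smul, mul_pow, Real.norm_eq_abs, sq_abs, norm_sub_rev w]
  simp only [hdir, inner_smul_right, Finset.sum_add_distrib, Finset.sum_sub_distrib,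
    ← Finset.mul_sum, hinner, hdist] at hsum
  exact hsum

lemma compositeObj_descent (hφ : ∀ i, IsConvexSmooth h (φ i) (D i)) (hr : ConvexOn ℝ Set.univ r)
    (hh : 0 < h) (h0 : 0 ≤ τ) (h1 : τ ≤ 1) (y z w : Agents m d)
    (u : EuclideanSpace ℝ (Fin d)) :
    m * (compositeObj φ r (τ • avg w + (1 - τ) • avg y) - compositeObj φ r u) ≤
      (1 - τ) * (m * (compositeObj φ r (avg y) - compositeObj φ r u)) +
      τ * (∑ i, r (w i) - m * r u +
        m * inner ℝ (avg (gradRows D (τ • z + (1 - τ) • y))) (avg w - u)) +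
      h / 2 * (disagreement (τ • z + (1 - τ) • y) + m * (τ ^ 2 * ‖avg w - avg z‖ ^ 2)) -
      (1 - τ) * (1 / (2 * h) *
        normSq (gradRows D (τ • z + (1 - τ) • y) - gradRows D (const m (avg y)))) := by
  have hsmooth := sum_smooth_descent hφ hh h0 h1 y z (avg w) u
  have hconv := mul_le_mul_of_nonneg_left
    (hr.2 (Set.mem_univ (avg w)) (Set.mem_univ (avg y)) h0 (sub_nonneg.mpr h1)
      (add_sub_cancel τ 1)) m.cast_nonneg
  have hjensen := mul_le_mul_of_nonneg_left (mul_apply_avg_le hr w) h0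
  simp only [mul_sub, mul_compositeObj, smul_eq_mul] at hconv ⊢
  linarith

lemma sum_prox_three_point (hg : ConvexOn ℝ Set.univ g) (hμ : 0 ≤ μ) (hγ : 0 ≤ γ)
    {z s w : Agents m d} (hw : w = proxStep μ γ g z s) (u : EuclideanSpace ℝ (Fin d)) :
    γ * (∑ i, quadShift μ g (w i) - m * quadShift μ g u) +
      γ * (m * inner ℝ (avg s) (avg w - u) + ∑ i, inner ℝ (dev s i) (dev w i)) +
      1 / 2 * normSq (w - z) + (1 + μ * γ) / 2 * normSq (w - const m u) ≤
      1 / 2 * normSq (z - const m u) := by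
  have hsum := Finset.sum_le_sum fun i (_ : i ∈ Finset.univ) =>
    prox_three_point hg hμ hγ (z i) (s i) u (congrFun hw i)
  simp only [Finset.sum_add_distrib, Finset.sum_sub_distrib, ← Finset.mul_sum, sum_inner_sub,
    Finset.sum_const, Finset.card_univ, Fintype.card_fin, nsmul_eq_mul] at hsum
  exact hsum

lemma disagreement_proxStep_le (hg : ConvexOn ℝ Set.univ g) (hμ : 0 ≤ μ) (hγ : 0 ≤ γ)
    {z s w : Agents m d} (hw : w = proxStep μ γ g z s) :
    disagreement w ≤ 2 * disagreement z + 4 * (γ ^ 2 * disagreement s) := by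
  have hprox := sum_prox_three_point hg hμ hγ hw (avg w)
  rw [normSq_sub_const, normSq_sub_const, sub_self, inner_zero_right, norm_zero,
    norm_sub_rev (avg z)] at hprox
  have hmove := mul_norm_avg_sub_sq_le w z
  have hjensen := mul_nonneg hγ
    (sub_nonneg.mpr (mul_apply_avg_le (convexOn_quadShift hμ hg) w))
  have hcross : -(γ * ∑ i, inner ℝ (dev s i) (dev w i)) ≤
      1 / 4 * disagreement w + γ ^ 2 * disagreement s := by
    have hyoung := neg_inner_dev_le (γ • s) w (a := 1 / 4) (b := 1) (by norm_num) (by norm_num)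
    simpa only [dev_smul, Pi.smul_apply, real_inner_smul_left, ← Finset.mul_sum,
      disagreement_smul, one_mul] using hyoung
  have hcurv : 0 ≤ μ * γ * disagreement w := mul_nonneg (by positivity) (disagreement_nonneg w)
  linarith

theorem round_descent (hp : IsStepSize h μ γ τ) (hφ : ∀ i, IsConvexSmooth h (φ i) (D i))
    (hg : ConvexOn ℝ Set.univ g) {x y z s w : Agents m d} (hx : x = τ • z + (1 - τ) • y)
    (hs : avg s = avg (gradRows D x)) (hw : w = proxStep μ γ g z s)
    (u : EuclideanSpace ℝ (Fin d)) :
    2 * m / μ * (compositeObj φ (quadShift μ g) (τ • avg w + (1 - τ) • avg y) -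
        compositeObj φ (quadShift μ g) u) + (1 + τ) * normSq (w - const m u) ≤
      (1 - τ) * (2 * m / μ * (compositeObj φ (quadShift μ g) (avg y) -
        compositeObj φ (quadShift μ g) u)) + normSq (z - const m u) +
      (disagreement w + γ ^ 2 * disagreement s + 1 / 400 * (disagreement x / τ ^ 2) -
        399 / 400 * (m * ‖avg w - avg z‖ ^ 2)) -
      (1 - τ) * (1 / (h * μ) * normSq (gradRows D x - gradRows D (const m (avg y)))) := by
  have hμ := hp.mu_pos
  have hγ := hp.gamma_pos
  have hh := hp.h_pos
  have hτ := hp.tau_pos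
  have hdescent := compositeObj_descent hφ (convexOn_quadShift hμ.le hg) hh hτ.le
    (by linarith [hp.tau_le]) y z w u
  have hprox := sum_prox_three_point hg hμ.le hγ.le hw u
  have hmove := mul_norm_avg_sub_sq_le w z
  have hcross : -(2 * γ * ∑ i, inner ℝ (dev s i) (dev w i)) ≤
      disagreement w + γ ^ 2 * disagreement s := by
    have hyoung := neg_inner_dev_le ((2 * γ) • s) w (a := 1) (b := 1 / 4) one_pos (by norm_num)
    simp only [dev_smul, Pi.smul_apply, real_inner_smul_left, ← Finset.mul_sum,
      disagreement_smul] at hyoung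
    linarith
  rw [← hx, ← hs] at hdescent
  rw [← hp.tau_eq] at hprox
  set P := ∑ i, quadShift μ g (w i) - m * quadShift μ g u + m * inner ℝ (avg s) (avg w - u)
  set Γ := normSq (gradRows D x - gradRows D (const m (avg y)))
  set F := compositeObj φ (quadShift μ g)
  have hscaled : 2 * m / μ * (F (τ • avg w + (1 - τ) • avg y) - F u) ≤
      (1 - τ) * (2 * m / μ * (F (avg y) - F u)) + 2 * (γ * P) +
      1 / 400 * (disagreement x / τ ^ 2 + m * ‖avg w - avg z‖ ^ 2) -
      (1 - τ) * (1 / (h * μ) * Γ) := by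
    calc 2 * m / μ * (F (τ • avg w + (1 - τ) • avg y) - F u)
        = 2 / μ * (m * (F (τ • avg w + (1 - τ) • avg y) - F u)) := by ring
      _ ≤ _ := mul_le_mul_of_nonneg_left hdescent (by positivity)
      _ = _ := by
        rw [← hp.mul_tau_sq_eq, show γ = τ / μ by rw [hp.tau_eq, mul_div_cancel_left₀ _ hμ.ne']]
        field_simp
  linarith

end Round

section Lyapunov

open Agents

variable {m d : ℕ} {φ : Fin m → EuclideanSpace ℝ (Fin d) → ℝ}
  {D : Fin m → EuclideanSpace ℝ (Fin d) → EuclideanSpace ℝ (Fin d)}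
  {g : EuclideanSpace ℝ (Fin d) → ℝ} {mix : Agents m d → Agents m d} {h μ γ τ : ℝ}

/-- The relation `q` is the state one round after `p`, for the aggregated gradient of `D`: each
variable is expressed through the ones updated before it. -/
structure IsRound (μ γ τ : ℝ) (D : Fin m → EuclideanSpace ℝ (Fin d) → EuclideanSpace ℝ (Fin d))
    (g : EuclideanSpace ℝ (Fin d) → ℝ) (mix : Agents m d → Agents m d) (p q : OdapgState m d) :
    Prop where
  x_eq : q.x = τ • p.z + (1 - τ) • p.y
  s_eq : q.s = mix (p.s + gradRows D q.x - gradRows D p.x)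
  z_eq : q.z = mix (proxStep μ γ g p.z q.s)
  y_eq : q.y = mix (τ • q.z + (1 - τ) • p.y)

lemma isRound_odapgStep (f : Fin m → EuclideanSpace ℝ (Fin d) → ℝ) (p : OdapgState m d) :
    IsRound μ γ τ (fun i v => gradient (f i) v - μ • v) g mix p
      (odapgStep μ γ τ f g mix p) where
  x_eq := rfl
  s_eq := rfl
  z_eq := rfl
  y_eq := rfl

lemma IsRound.avg_s_eq {p q : OdapgState m d} (hq : IsRound μ γ τ D g mix p q)
    (hmix : ∀ x, avg (mix x) = avg x) (hp : avg p.s = avg (gradRows D p.x)) :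
    avg q.s = avg (gradRows D q.x) := by
  rw [hq.s_eq, hmix, avg_sub, avg_add, hp, add_sub_cancel_left]

lemma avg_odapg_s {f : Fin m → EuclideanSpace ℝ (Fin d) → ℝ} (hmix : ∀ x, avg (mix x) = avg x)
    (x₁ : EuclideanSpace ℝ (Fin d)) (n : ℕ) :
    avg (odapg μ γ τ f g mix x₁ n).s =
      avg (gradRows (fun i v => gradient (f i) v - μ • v) (odapg μ γ τ f g mix x₁ n).x) := by
  induction n with
  | zero => rfl
  | succ n ih => exact (isRound_odapgStep f _).avg_s_eq hmix ih

lemma disagreement_gradRows_sub_le (hφ : ∀ i, IsConvexSmooth h (φ i) (D i)) (hh : 0 < h)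
    (x x' : Agents m d) (v : EuclideanSpace ℝ (Fin d)) :
    disagreement (gradRows D x' - gradRows D x) ≤
      2 * normSq (gradRows D x' - gradRows D (const m v)) +
        2 * (h ^ 2 * normSq (x - const m v)) := by
  have hlip : normSq (gradRows D (const m v) - gradRows D x) ≤ h ^ 2 * normSq (x - const m v) := by
    simp only [normSq, Finset.mul_sum]
    refine Finset.sum_le_sum fun i _ => ?_
    rw [Pi.sub_apply, Pi.sub_apply, norm_sub_rev (x i)]
    exact (hφ i).norm_sub_sq_le hh (x i) v
  rw [← sub_add_sub_cancel _ (gradRows D (const m v))]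
  linarith [disagreement_le_normSq (gradRows D x' - gradRows D (const m v) +
      (gradRows D (const m v) - gradRows D x)),
    normSq_add_le (gradRows D x' - gradRows D (const m v))
      (gradRows D (const m v) - gradRows D x)]

lemma disagreement_interpolation_le (h0 : 0 < τ) (h1 : τ ≤ 1) (a b : Agents m d) :
    disagreement (τ • a + (1 - τ) • b) / τ ^ 2 ≤
      2 * disagreement a + 2 * (disagreement b / τ ^ 2) := by
  have hb := disagreement_nonneg b
  have hsq : (1 - τ) ^ 2 ≤ 1 := pow_le_one₀ (by linarith) (by linarith)
  calc disagreement (τ • a + (1 - τ) • b) / τ ^ 2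
      ≤ (2 * (τ ^ 2 * disagreement a) + 2 * ((1 - τ) ^ 2 * disagreement b)) / τ ^ 2 := by
        rw [← disagreement_smul, ← disagreement_smul]
        gcongr
        exact disagreement_add_le _ _
    _ ≤ (2 * (τ ^ 2 * disagreement a) + 2 * (1 * disagreement b)) / τ ^ 2 := by gcongr
    _ = 2 * disagreement a + 2 * (disagreement b / τ ^ 2) := by field_simp

/-- The consensus errors of the four variables and the distance of the averages of `x` and `y`,
with the weights of the Lyapunov function. -/
noncomputable def consensusError (τ γ : ℝ) (p : OdapgState m d) : ℝ :=
  disagreement p.x / τ ^ 2 + 3 * (disagreement p.y / τ ^ 2) + 6 * disagreement p.z +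
    γ ^ 2 * disagreement p.s + 1 / 4 * (m * ‖avg p.x - avg p.y‖ ^ 2 / τ ^ 2)

lemma consensusError_nonneg (τ γ : ℝ) (p : OdapgState m d) : 0 ≤ consensusError τ γ p := by
  have := disagreement_nonneg p.x
  have := disagreement_nonneg p.y
  have := disagreement_nonneg p.z
  have := disagreement_nonneg p.s
  unfold consensusError
  positivity

namespace IsRound

variable {p q : OdapgState m d} (hq : IsRound μ γ τ D g mix p q)
include hq

lemma avg_y_eq (hmix : ∀ x, avg (mix x) = avg x) :
    avg q.y = τ • avg (proxStep μ γ g p.z q.s) + (1 - τ) • avg p.y := by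
  rw [hq.y_eq, hmix, avg_add, avg_smul, avg_smul, hq.z_eq, hmix]

lemma norm_avg_x_sub_avg_y_sq (hmix : ∀ x, avg (mix x) = avg x) :
    ‖avg q.x - avg q.y‖ ^ 2 = τ ^ 2 * ‖avg (proxStep μ γ g p.z q.s) - avg p.z‖ ^ 2 := by
  have hdiff : avg q.x - avg q.y = τ • (avg p.z - avg (proxStep μ γ g p.z q.s)) := by
    rw [hq.avg_y_eq hmix, hq.x_eq, avg_add, avg_smul, avg_smul]
    module
  rw [hdiff, norm_smul, mul_pow, Real.norm_eq_abs, sq_abs, norm_sub_rev]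

lemma normSq_z_sub_le {δ : ℝ} (hδ : δ ≤ 1) (hmix : IsConsensusContraction δ mix)
    (u : EuclideanSpace ℝ (Fin d)) :
    normSq (q.z - const m u) ≤ normSq (proxStep μ γ g p.z q.s - const m u) := by
  rw [normSq_sub_const, normSq_sub_const, hq.z_eq, hmix.avg_eq]
  gcongr
  exact ((hmix.mono hδ).disagreement_le _).trans_eq (one_mul _)

lemma disagreement_s_le {δ : ℝ} (hδ : 0 ≤ δ) (hp : IsStepSize h μ γ τ)
    (hφ : ∀ i, IsConvexSmooth h (φ i) (D i)) (hmix : IsConsensusContraction δ mix) :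
    γ ^ 2 * disagreement q.s ≤ δ * (2 * (γ ^ 2 * disagreement p.s) +
      1 / 100 * (1 / (h * μ) * normSq (gradRows D q.x - gradRows D (const m (avg p.y)))) +
      1 / 40000 * (disagreement p.x / τ ^ 2 + m * ‖avg p.x - avg p.y‖ ^ 2 / τ ^ 2)) := by
  have hμ := hp.mu_pos
  have hh := hp.h_pos
  have hγ := hp.gamma_pos
  have hincr := disagreement_gradRows_sub_le hφ hh p.x q.x (avg p.y)
  rw [normSq_sub_const] at hincr
  have hadd := disagreement_add_le p.s (gradRows D q.x - gradRows D p.x)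
  have hcontr := hmix.disagreement_le (p.s + (gradRows D q.x - gradRows D p.x))
  rw [← add_sub_assoc, ← hq.s_eq, add_sub_assoc] at hcontr
  set Γ := normSq (gradRows D q.x - gradRows D (const m (avg p.y)))
  set X := disagreement p.x
  set N := m * ‖avg p.x - avg p.y‖ ^ 2
  calc γ ^ 2 * disagreement q.s
      ≤ γ ^ 2 * (δ * (2 * disagreement p.s + 2 * (2 * Γ + 2 * (h ^ 2 * (X + N))))) := by
        gcongr
        refine hcontr.trans ?_
        gcongr
        linarith
    _ = δ * (2 * (γ ^ 2 * disagreement p.s) + 4 * (h * γ * τ) * (1 / (h * μ) * Γ) +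
          4 * (h * γ * τ) ^ 2 * (X / τ ^ 2 + N / τ ^ 2)) := by
        rw [hp.tau_eq]
        field_simp
        ring
    _ = _ := by
        rw [hp.mul_mul_eq]
        ring

theorem consensusError_add_le (hp : IsStepSize h μ γ τ) (hφ : ∀ i, IsConvexSmooth h (φ i) (D i))
    (hg : ConvexOn ℝ Set.univ g) (hmix : IsConsensusContraction (1 / 16) mix)
    {w : Agents m d} (hw : w = proxStep μ γ g p.z q.s) :
    consensusError τ γ q + (disagreement w + γ ^ 2 * disagreement q.s +
        1 / 400 * (disagreement q.x / τ ^ 2) - 399 / 400 * (m * ‖avg w - avg p.z‖ ^ 2)) ≤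
      39 / 40 * consensusError τ γ p +
      (1 - τ) * (1 / (h * μ) *
        normSq (gradRows D q.x - gradRows D (const m (avg p.y)))) := by
  have hτ := hp.tau_pos
  have hτ1 := hp.tau_le
  have hμ := hp.mu_pos
  have hh := hp.h_pos
  have hinterp := disagreement_interpolation_le (m := m) (d := d) hτ (by linarith)
  have hx : disagreement q.x / τ ^ 2 ≤ 2 * disagreement p.z + 2 * (disagreement p.y / τ ^ 2) :=
    hq.x_eq ▸ hinterp p.z p.y
  have hs := hq.disagreement_s_le (by norm_num) hp hφ hmix
  have hprox := disagreement_proxStep_le hg hμ.le hp.gamma_pos.le hw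
  have hz : disagreement q.z ≤ 1 / 16 * disagreement w :=
    hq.z_eq ▸ hw ▸ hmix.disagreement_le w
  have hy : disagreement q.y / τ ^ 2 ≤
      1 / 16 * (2 * disagreement q.z + 2 * (disagreement p.y / τ ^ 2)) := by
    rw [hq.y_eq]
    refine (div_le_div_of_nonneg_right (hmix.disagreement_le _) (sq_nonneg τ)).trans ?_
    rw [mul_div_assoc]
    gcongr
    exact hinterp q.z p.y
  have hxy : m * ‖avg q.x - avg q.y‖ ^ 2 / τ ^ 2 = m * ‖avg w - avg p.z‖ ^ 2 := by
    rw [hq.norm_avg_x_sub_avg_y_sq hmix.avg_eq, hw]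
    field_simp
  have hX := div_nonneg (disagreement_nonneg p.x) (sq_nonneg τ)
  have hY := div_nonneg (disagreement_nonneg p.y) (sq_nonneg τ)
  have hZ := disagreement_nonneg p.z
  have hS := mul_nonneg (sq_nonneg γ) (disagreement_nonneg p.s)
  have hN : 0 ≤ m * ‖avg p.x - avg p.y‖ ^ 2 / τ ^ 2 := by positivity
  have hN' : 0 ≤ m * ‖avg w - avg p.z‖ ^ 2 := by positivity
  have hΓ := mul_nonneg (by positivity : 0 ≤ 1 / (h * μ))
    (normSq_nonneg (gradRows D q.x - gradRows D (const m (avg p.y))))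
  have hτΓ := mul_le_mul_of_nonneg_right (by linarith : 19 / 20 ≤ 1 - τ) hΓ
  rw [consensusError, consensusError, hxy]
  linarith

theorem lyapunov_le (hp : IsStepSize h μ γ τ) (hφ : ∀ i, IsConvexSmooth h (φ i) (D i))
    (hg : ConvexOn ℝ Set.univ g) (hmix : IsConsensusContraction (1 / 16) mix)
    (htrack : avg p.s = avg (gradRows D p.x)) (u : EuclideanSpace ℝ (Fin d)) :
    2 * m / μ * (compositeObj φ (quadShift μ g) (avg q.y) - compositeObj φ (quadShift μ g) u) +
        (1 + τ) * normSq (q.z - const m u) + consensusError τ γ q ≤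
      (1 - τ) * (2 * m / μ *
          (compositeObj φ (quadShift μ g) (avg p.y) - compositeObj φ (quadShift μ g) u)) +
        normSq (p.z - const m u) + 39 / 40 * consensusError τ γ p := by
  have hdescent := round_descent hp hφ hg hq.x_eq (hq.avg_s_eq hmix.avg_eq htrack) rfl u
  have herror := hq.consensusError_add_le hp hφ hg hmix rfl
  have hz := mul_le_mul_of_nonneg_left (hq.normSq_z_sub_le (by norm_num) hmix u)
    (by linarith [hp.tau_pos] : 0 ≤ 1 + τ)
  rw [hq.avg_y_eq hmix.avg_eq]
  linarith

end IsRound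

end Lyapunov

section Convergence

open Agents

variable {m d : ℕ}

lemma le_pow_mul_of_lyapunov_le {B Z E : ℕ → ℝ} {τ ρ : ℝ} (h0 : 0 ≤ τ) (h1 : τ ≤ 1) (hρ0 : 0 ≤ ρ)
    (hρ : ρ ≤ 1 - τ / 2) (hB : ∀ n, 0 ≤ B n) (hZ : ∀ n, 0 ≤ Z n) (hE : ∀ n, 0 ≤ E n)
    (hinit : Z 0 ≤ B 0)
    (hstep : ∀ n, B (n + 1) + (1 + τ) * Z (n + 1) + E (n + 1) ≤ (1 - τ) * B n + Z n + ρ * E n)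
    (n : ℕ) : Z n ≤ (1 - τ / 2) ^ (n + 1) * (B 0 + Z 0 + E 0) := by
  have hrate : 0 ≤ 1 - τ / 2 := hρ0.trans hρ
  have hrest (n : ℕ) : 0 ≤ (1 - τ) * B n + ρ * E n :=
    add_nonneg (mul_nonneg (sub_nonneg.mpr h1) (hB n)) (mul_nonneg hρ0 (hE n))
  have hcontr (n : ℕ) : (1 - τ) * B (n + 1) + Z (n + 1) + ρ * E (n + 1) ≤
      (1 - τ / 2) * ((1 - τ) * B n + Z n + ρ * E n) := by
    calc (1 - τ) * B (n + 1) + Z (n + 1) + ρ * E (n + 1)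
        ≤ (1 - τ / 2) * B (n + 1) + (1 - τ / 2) * (1 + τ) * Z (n + 1) +
            (1 - τ / 2) * E (n + 1) := by
          have hBn := hB (n + 1)
          have hZn := hZ (n + 1)
          have hEn := hE (n + 1)
          have hcoef : 1 ≤ (1 - τ / 2) * (1 + τ) := by nlinarith
          gcongr
          · linarith
          · exact le_mul_of_one_le_left hZn hcoef
      _ = (1 - τ / 2) * (B (n + 1) + (1 + τ) * Z (n + 1) + E (n + 1)) := by ring
      _ ≤ _ := mul_le_mul_of_nonneg_left (hstep n) hrate
  have hfirst : (1 - τ) * B 0 + Z 0 + ρ * E 0 ≤ (1 - τ / 2) * (B 0 + Z 0 + E 0) := by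
    have hτ := mul_le_mul_of_nonneg_left hinit h0
    have hE0 := mul_le_mul_of_nonneg_right hρ (hE 0)
    linarith
  calc Z n ≤ (1 - τ) * B n + Z n + ρ * E n := by linarith [hrest n]
    _ ≤ (1 - τ / 2) ^ n * ((1 - τ) * B 0 + Z 0 + ρ * E 0) :=
      le_geom (u := fun n => (1 - τ) * B n + Z n + ρ * E n) hrate n fun k _ => hcontr k
    _ ≤ (1 - τ / 2) ^ n * ((1 - τ / 2) * (B 0 + Z 0 + E 0)) := by gcongr
    _ = (1 - τ / 2) ^ (n + 1) * (B 0 + Z 0 + E 0) := by ring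

lemma mul_norm_sub_sq_le_compositeObj_sub (hm : 0 < m)
    {f : Fin m → EuclideanSpace ℝ (Fin d) → ℝ} {g : EuclideanSpace ℝ (Fin d) → ℝ} {μ : ℝ}
    (hμ : 0 < μ) (hf : ∀ i, StrongConvexOn Set.univ μ (f i)) (hg : ConvexOn ℝ Set.univ g)
    {w : EuclideanSpace ℝ (Fin d)} (hw : IsMinOn (compositeObj f g) Set.univ w)
    (v : EuclideanSpace ℝ (Fin d)) :
    m * ‖v - w‖ ^ 2 ≤ 2 * m / μ * (compositeObj f g v - compositeObj f g w) := by
  have hgrowth := add_norm_sub_sq_le_of_isMinOn (strongConvexOn_compositeObj hm hf hg) hw v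
  calc m * ‖v - w‖ ^ 2 = 2 * m / μ * (μ / 2 * ‖v - w‖ ^ 2) := by field_simp
    _ ≤ _ := by
      gcongr
      linarith

lemma consensusError_odapgInit_le {h μ γ τ : ℝ} (hp : IsStepSize h μ γ τ)
    (f : Fin m → EuclideanSpace ℝ (Fin d) → ℝ) (x₁ : EuclideanSpace ℝ (Fin d)) :
    consensusError τ γ (odapgInit μ f x₁) ≤ 6 * 20 ^ 2 * h / μ *
      (disagreement (odapgInit μ f x₁).x + 64 * disagreement (odapgInit μ f x₁).y +
        9 * τ ^ 2 / 32 * disagreement (odapgInit μ f x₁).z +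
        5 * τ ^ 2 / 14 * γ ^ 2 * disagreement (odapgInit μ f x₁).s) := by
  have hx : disagreement (odapgInit μ f x₁).x = 0 := disagreement_const x₁
  have hy : disagreement (odapgInit μ f x₁).y = 0 := disagreement_const x₁
  have hz : disagreement (odapgInit μ f x₁).z = 0 := disagreement_const x₁
  have hxy : (odapgInit μ f x₁).x = (odapgInit μ f x₁).y := rfl
  have hs := mul_nonneg (sq_nonneg γ) (disagreement_nonneg (odapgInit μ f x₁).s)
  rw [consensusError, hx, hy, hz, hxy, sub_self, norm_zero]
  calc _ = γ ^ 2 * disagreement (odapgInit μ f x₁).s := by ring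
    _ ≤ 6 * 20 ^ 2 * 5 / 14 * (1 / 400) * (γ ^ 2 * disagreement (odapgInit μ f x₁).s) := by
      linarith
    _ = _ := by
      rw [← hp.mul_tau_sq_eq]
      ring

theorem theorem3_general {m d : ℕ} (hm : 0 < m)
    {f : Fin m → EuclideanSpace ℝ (Fin d) → ℝ} {g : EuclideanSpace ℝ (Fin d) → ℝ}
    {L μ : ℝ} (hμ : 0 < μ) (hL : 2 * μ ≤ L)
    (hf_smooth : ∀ i, IsLSmooth L (f i))
    (hf_strong : ∀ i, StrongConvexOn Set.univ μ (f i))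
    (hg : ConvexOn ℝ Set.univ g)
    {mix : Agents m d → Agents m d} (hmix : IsConsensusContraction (1 / 16) mix)
    {xstar : EuclideanSpace ℝ (Fin d)} (hstar : IsMinOn (compositeObj f g) Set.univ xstar)
    {x₁ : EuclideanSpace ℝ (Fin d)}
    {γ τ : ℝ} (hγ : γ = 1 / (20 * √((L - μ) * μ))) (hτ : τ = μ * γ)
    {state : ℕ → OdapgState m d} (hstate : state = odapg μ γ τ f g mix x₁)
    {T : ℕ} (hT : 1 ≤ T) :
    Agents.normSq ((state (T - 1)).z - Agents.const m xstar) ≤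
      (1 - 1 / 40 * √(μ / (L - μ))) ^ T *
        (2 * (m : ℝ) / μ *
            (compositeObj f g (Agents.avg (state 0).y) - compositeObj f g xstar)
          + Agents.normSq ((state 0).z - Agents.const m xstar)
          + 6 * 20 ^ 2 * (L - μ) / μ *
            (Agents.normSq (Agents.leftMul (consensusProj m) (state 0).x)
              + 64 * Agents.normSq (Agents.leftMul (consensusProj m) (state 0).y)
              + 9 * τ ^ 2 / 32 *
                Agents.normSq (Agents.leftMul (consensusProj m) (state 0).z)
              + 5 * τ ^ 2 / 14 * γ ^ 2 *
                Agents.normSq (Agents.leftMul (consensusProj m) (state 0).s))) := by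
  subst hstate
  have hp : IsStepSize (L - μ) μ γ τ := .of_eq hμ (by linarith) hγ hτ
  have hτ0 := hp.tau_pos
  have hτ1 := hp.tau_le
  have hφ i := (hf_smooth i).isConvexSmooth_quadShift (hf_strong i)
  have hgrowth := mul_norm_sub_sq_le_compositeObj_sub hm hμ hf_strong hg hstar
  have hinit : normSq (const m x₁ - const m xstar) ≤
      2 * m / μ * (compositeObj f g (avg (const m x₁)) - compositeObj f g xstar) := by
    rw [normSq_sub_const, disagreement_const, zero_add]
    exact hgrowth _
  have hstep n := (isRound_odapgStep f (odapg μ γ τ f g mix x₁ n)).lyapunov_le hp hφ hg hmix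
    (avg_odapg_s hmix.avg_eq x₁ n) xstar
  simp only [compositeObj_quadShift hm] at hstep
  have hdecay := le_pow_mul_of_lyapunov_le
    (B := fun n => 2 * m / μ *
      (compositeObj f g (avg (odapg μ γ τ f g mix x₁ n).y) - compositeObj f g xstar))
    (Z := fun n => normSq ((odapg μ γ τ f g mix x₁ n).z - const m xstar))
    (E := fun n => consensusError τ γ (odapg μ γ τ f g mix x₁ n))
    hτ0.le (by linarith) (by norm_num) (by linarith : (39 / 40 : ℝ) ≤ 1 - τ / 2)
    (fun n => (by positivity : (0 : ℝ) ≤ _).trans (hgrowth (avg (odapg μ γ τ f g mix x₁ n).y)))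
    (fun n => normSq_nonneg _) (fun n => consensusError_nonneg _ _ _) hinit hstep (T - 1)
  rw [Nat.sub_add_cancel hT, hp.half_tau_eq] at hdecay
  refine hdecay.trans ?_
  have hrate : 0 ≤ 1 - 1 / 40 * √(μ / (L - μ)) := by linarith [hp.half_tau_eq]
  simp only [leftMul_consensusProj]
  gcongr
  exact consensusError_odapgInit_le hp f x₁

end Convergence

theorem theorem3 {m d : ℕ} (hm : 2 ≤ m)
    (f : Fin m → EuclideanSpace ℝ (Fin d) → ℝ) (g : EuclideanSpace ℝ (Fin d) → ℝ)
    (L μ : ℝ) (hμ : 0 < μ) (hL : 2 * μ ≤ L)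
    (hf_smooth : ∀ i, IsLSmooth L (f i))
    (hf_strong : ∀ i, StrongConvexOn Set.univ μ (f i))
    (hg : ConvexOn ℝ Set.univ g)
    (G : SimpleGraph (Fin m)) (W : Matrix (Fin m) (Fin m) ℝ) (hW : IsWeightMatrix G W)
    (xstar : EuclideanSpace ℝ (Fin d)) (hstar : IsMinOn (compositeObj f g) Set.univ xstar)
    (x₁ : EuclideanSpace ℝ (Fin d))
    (γ τ lam : ℝ) (hγ : γ = 1 / (20 * √((L - μ) * μ))) (hτ : τ = μ * γ)
    (hlam : lam = lambda2 hW.posSemidef.isHermitian hm)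
    (K : ℕ) (hK : 11 / √(1 - lam) ≤ (K : ℝ))
    (state : ℕ → OdapgState m d)
    (hstate : state = odapg μ γ τ f g (fastMix W (mixEta lam) K) x₁)
    (T : ℕ) (hT : 1 ≤ T) :
    Agents.normSq ((state (T - 1)).z - Agents.const m xstar) ≤
      (1 - 1 / 40 * √(μ / (L - μ))) ^ T *
        (2 * (m : ℝ) / μ *
            (compositeObj f g (Agents.avg (state 0).y) - compositeObj f g xstar)
          + Agents.normSq ((state 0).z - Agents.const m xstar)
          + 6 * 20 ^ 2 * (L - μ) / μ *
            (Agents.normSq (Agents.leftMul (consensusProj m) (state 0).x)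
              + 64 * Agents.normSq (Agents.leftMul (consensusProj m) (state 0).y)
              + 9 * τ ^ 2 / 32 *
                Agents.normSq (Agents.leftMul (consensusProj m) (state 0).z)
              + 5 * τ ^ 2 / 14 * γ ^ 2 *
                Agents.normSq (Agents.leftMul (consensusProj m) (state 0).s))) :=
  theorem3_general (by omega) hμ hL hf_smooth hf_strong hg
    ((hW.isConsensusContraction_fastMix hm hlam hK).mono (by norm_num)) hstar hγ hτ hstate hT
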